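/- Let $V$ be a finite set of $n$ nodes with metric edge costs $c_{uv}$ on the complete graph on $V$ (nonnegative reals, symmetric, satisfying the triangle inequality), let $k\ge 1$, and let $r_1,\dots,r_k\in V$ be (not necessarily distinct) depots. A feasible solution of the multi-depot $k$-vehicle minimum latency problem (multi-depot $k$-MLP) consists of paths $P_1,\dots,P_k$ (sequences of distinct nodes), where $P_i$ starts at $r_i$, that together visit all nodes of $V$. Its cost is the total latency $\sum_{i=1}^k\sum_{v\in P_i,\,v\ne r_i}c_{P_i}(v)$, where $c_{P_i}(v)$ is the distance from $r_i$ to $v$ along $P_i$. For $1\le\ell\le n$ let $b^*_{k,\ell}$ be the minimum of $\max_i c(P_i)$ over all $k$-tuples of paths $P_1,\dots,P_k$, with $P_i$ starting at $r_i$, that together visit at least $\ell$ nodes (depots included), where $c(P_i)$ is the sum of the edge costs of $P_i$. Define the bottleneck-stroll lower bound $\mathsf{BNSLB}:=\sum_{\ell=1}^{n}b^*_{k,\ell}$. Let $\mu^*\approx 3.5911$ be the unique positive real solution of $\mu\ln\mu=\mu+1$. Theorem. (i) Every instance of multi-depot $k$-MLP has a feasible solution of cost at most $\mu^*\cdot\mathsf{BNSLB}$.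 (ii) Every instance of the single-vehicle problem MLP (that is, $k=1$) has a feasible solution of cost at most $3.03\cdot\mathsf{BNSLB}$. -/

import Mathlib

/-! Multi-depot `k`-vehicle minimum latency problem on a finite (pseudo)metric space `V`: the
complete graph on `V` with edge costs `dist u v`. -/

namespace MLP

/-- The constant `μ*` exists: `μ ln μ = μ + 1` has exactly one positive real solution.
(Positivity matters only because `Real.log x = log |x|` for negative `x`.) -/
theorem existsUnique_mu : ∃! μ : ℝ, 0 < μ ∧ μ * Real.log μ = μ + 1 := by
  have key : ∀ x : ℝ, 0 < x → x * Real.log x = x + 1 → 1 < x := by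
    intro x hx h
    by_contra hle
    have h1 : Real.log x ≤ 0 := Real.log_nonpos hx.le (not_lt.mp hle)
    nlinarith [mul_nonneg hx.le (neg_nonneg.mpr h1)]
  have hcont : ContinuousOn (fun x : ℝ => x * Real.log x - x) (Set.Icc 1 (Real.exp 2)) := by
    exact (Real.continuous_mul_log.sub continuous_id).continuousOn
  have h12 : (1 : ℝ) ≤ Real.exp 2 := Real.one_le_exp (by norm_num)
  have hmem : (1 : ℝ) ∈ Set.Icc ((1 : ℝ) * Real.log 1 - 1)
      (Real.exp 2 * Real.log (Real.exp 2) - Real.exp 2) := by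
    rw [Real.log_exp, Real.log_one]
    constructor <;> linarith
  obtain ⟨m, hm, hm1⟩ := intermediate_value_Icc h12 hcont hmem
  have hm0 : 0 < m := lt_of_lt_of_le one_pos hm.1
  have hlt : ∀ a b : ℝ, 1 < a → a < b → a * Real.log a = a + 1 → b * Real.log b = b + 1 →
      False := by
    intro a b ha hab hA hB
    have ha0 : 0 < a := by linarith
    have hla : 1 < Real.log a := by
      by_contra hle
      nlinarith [mul_le_mul_of_nonneg_left (not_lt.mp hle) ha0.le]
    have hlab : Real.log a < Real.log b := Real.log_lt_log ha0 hab
    nlinarith [mul_pos (sub_pos.mpr hab) (sub_pos.mpr hla),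
      mul_pos (ha0.trans hab) (sub_pos.mpr hlab)]
  refine ⟨m, ⟨hm0, by simp only at hm1; linarith⟩, ?_⟩
  rintro y ⟨hy0, hy⟩
  have hm2 : m * Real.log m = m + 1 := by simp only at hm1; linarith
  rcases lt_trichotomy y m with h | h | h
  · exact (hlt y m (key y hy0 hy) h hy hm2).elim
  · exact h
  · exact (hlt m y (key m hm0 hm2) h hm2 hy).elim

/-- `μ*`, the solution of `μ ln μ = μ + 1` (about `3.5911`). -/
noncomputable def muStar : ℝ := existsUnique_mu.choose

theorem muStar_spec : 0 < muStar ∧ muStar * Real.log muStar = muStar + 1 :=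
  existsUnique_mu.choose_spec.1

/-- A path of the complete graph on `V` that starts at `r`: the list of its (distinct) nodes, in
the order in which they are visited. -/
@[ext] structure RootedPath {V : Type*} (r : V) where
  nodes : List V
  head_eq : nodes.head? = some r
  nodup : nodes.Nodup

/-- Total length of the consecutive steps of a sequence of nodes. -/
def seqCost {V : Type*} [PseudoMetricSpace V] : List V → ℝ
  | [] => 0
  | [_] => 0
  | a :: b :: l => dist a b + seqCost (b :: l)

/-- The cost `c(P)` of a path: the sum of its edge costs. -/
def RootedPath.cost {V : Type*} [PseudoMetricSpace V] {r : V} (P : RootedPath r) : ℝ :=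
  seqCost P.nodes

/-- `c_P(v)`, the latency of a node `v` of `P`: the distance from the root to `v` along `P`, i.e.
the cost of the initial part of `P` that ends in `v`. -/
def RootedPath.latency {V : Type*} [DecidableEq V] [PseudoMetricSpace V] {r : V}
    (P : RootedPath r) (v : V) : ℝ :=
  seqCost (P.nodes.take (P.nodes.idxOf v + 1))

/-- `k` paths, the `i`-th one starting at the depot `r i` (depots need not be distinct). -/
abbrev PathFamily {V : Type*} {k : ℕ} (r : Fin k → V) := (i : Fin k) → RootedPath (r i)

/-- The set of all nodes visited by the `k` paths. -/
def PathFamily.covered {V : Type*} [DecidableEq V] {k : ℕ} {r : Fin k → V}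
    (P : PathFamily r) : Finset V :=
  Finset.univ.biUnion fun i => (P i).nodes.toFinset

/-- Feasible solutions of multi-depot `k`-MLP: the paths together visit all nodes. -/
def PathFamily.IsFeasible {V : Type*} [DecidableEq V] {k : ℕ} {r : Fin k → V}
    (P : PathFamily r) : Prop :=
  ∀ v : V, v ∈ P.covered

/-- The objective of multi-depot `k`-MLP: `∑ i, ∑ v ∈ P i with v ≠ r i, c_{P i}(v)`. -/
def PathFamily.totalLatency {V : Type*} [DecidableEq V] [PseudoMetricSpace V] {k : ℕ}
    {r : Fin k → V} (P : PathFamily r) : ℝ :=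
  ∑ i, ∑ v ∈ (P i).nodes.toFinset.erase (r i), (P i).latency v

/-- The objective of the bottleneck-stroll problem: `max_i c(P i)`. -/
noncomputable def PathFamily.bottleneck {V : Type*} [PseudoMetricSpace V] {k : ℕ}
    {r : Fin k → V} (P : PathFamily r) : ℝ :=
  ⨆ i, (P i).cost

/-- The optimal value of the `(k, ℓ)`-bottleneck-stroll problem: the least bottleneck cost of `k`
rooted paths that together cover at least `ℓ` nodes. For `1 ≤ k` and `ℓ ≤ |V|` this infimum is an
attained minimum, see `isLeast_optBNS`. -/
noncomputable def optBNS {V : Type*} [DecidableEq V] [PseudoMetricSpace V] {k : ℕ}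
    (r : Fin k → V) (l : ℕ) : ℝ :=
  sInf {t : ℝ | ∃ P : PathFamily r, l ≤ P.covered.card ∧ P.bottleneck = t}

/-- The bottleneck-stroll lower bound: the sum of the optimal values of the
`(k, ℓ)`-bottleneck-stroll problems for `ℓ = 1, …, |V|`. -/
noncomputable def bnslb {V : Type*} [Fintype V] [DecidableEq V] [PseudoMetricSpace V] {k : ℕ}
    (r : Fin k → V) : ℝ :=
  ∑ l ∈ Finset.Icc 1 (Fintype.card V), optBNS r l

/-- A path that visits all nodes. -/
theorem exists_spanning {V : Type*} [Fintype V] [DecidableEq V] (r : V) :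
    ∃ P : RootedPath r, ∀ v : V, v ∈ P.nodes := by
  refine ⟨⟨r :: (Finset.univ.erase r).toList, rfl, ?_⟩, ?_⟩
  · simp [Finset.nodup_toList]
  · intro v
    by_cases h : v = r <;> simp [h]

instance instFiniteRootedPath {V : Type*} [Finite V] (r : V) : Finite (RootedPath r) := by
  classical
  have := Fintype.ofFinite V
  exact Finite.of_injective (β := {l : List V // l.Nodup}) (fun P => ⟨P.nodes, P.nodup⟩)
    (fun P Q h => RootedPath.ext (congrArg Subtype.val h))

theorem isLeast_optBNS {V : Type*} [Fintype V] [DecidableEq V] [PseudoMetricSpace V] {k : ℕ}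
    (hk : 0 < k) (r : Fin k → V) {l : ℕ} (hl : l ≤ Fintype.card V) :
    IsLeast {t : ℝ | ∃ P : PathFamily r, l ≤ P.covered.card ∧ P.bottleneck = t}
      (optBNS r l) := by
  have hne : {t : ℝ | ∃ P : PathFamily r, l ≤ P.covered.card ∧ P.bottleneck = t}.Nonempty := by
    choose P hP using fun i => exists_spanning (r i)
    refine ⟨_, P, ?_, rfl⟩
    have : PathFamily.covered P = Finset.univ := by
      ext v
      simp only [PathFamily.covered, Finset.mem_biUnion, Finset.mem_univ, true_and,
        List.mem_toFinset, iff_true]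
      exact ⟨⟨0, hk⟩, hP _ v⟩
    rw [this, Finset.card_univ]
    exact hl
  have hfin : {t : ℝ | ∃ P : PathFamily r, l ≤ P.covered.card ∧ P.bottleneck = t}.Finite := by
    refine (Set.finite_range (fun P : PathFamily r => P.bottleneck)).subset ?_
    rintro t ⟨P, -, rfl⟩
    exact ⟨P, rfl⟩
  exact ⟨hne.csInf_mem hfin, fun t ht => csInf_le hfin.bddBelow ht⟩

end MLP

/-!
The solution is built in rounds. In round `i` every vehicle follows its path of an optimal family
of strolls that covers `l i` nodes, shortcut to the nodes not visited before, and returns directly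
to its depot (`PathFamily.exists_round`). If such a closed tour costs at most `T` and the nodes
served in the round have latency `a` within it on average, the round contributes `a` for each node
left before it and `T - a` for each node left after it (`PathFamily.exists_concat`). There are two
estimates for `a`:

* the better of the two orientations of a tour serves its nodes at average latency at most `T / 2`
  (`PathFamily.serves_half`);
* for a single vehicle, a path of cost `b` whose end has distance `d` from the root, so that
  `T = b + d`, visits a node `v` not later than `b - d + dist r v` (`PathFamily.serves_forward`);
  the distances `dist r v` sum to at most `bnslb` (`sum_dist_le_bnslb`).

The numbers `l i` are chosen by the number of nodes left over, as `n - ⌊x i⌋` with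
`x i = n v / c ^ i` and `1 / c ≤ v ≤ 1`. Let `b x` be the optimal stroll value for `n - ⌊x⌋` nodes.
With respect to `dv / v`, the average of `∑ i, b (x i) * x i` is at most `bnslb / log c`, because
the intervals swept out by the `x i` tile `(0, n]` (`mul_log_le_of_forall_le_sum`).

For `k` vehicles, `T ≤ 2 b` and the first estimate bound a round by `(c + 1) * b x * x`, so the
factor is `(c + 1) / log c`; it is smallest at `c = μ*`, where it equals `μ*`.

For one vehicle the second estimate is good where `d` is large, the first where `d` is small. Mix
them with weights `5 / 9` and `4 / 9`: for `c = 4` the coefficient of `d` in a round is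
`(4 * ⌊x⌋ - ⌊4 * x⌋) / 3 ≤ 0`, whatever the `d` are, and what remains is at most
`(10 / 3) * b x * x`. The factor is `5 / 9 + (10 / 3) / log 4 < 2.961`.
-/

namespace MLP
open Finset

/-! ### Lengths of sequences of nodes -/

section SeqCost

variable {V : Type*} [PseudoMetricSpace V]

theorem seqCost_nonneg : ∀ l : List V, 0 ≤ seqCost l
  | [] => le_rfl
  | [_] => le_rfl
  | _ :: b :: l => add_nonneg dist_nonneg (seqCost_nonneg (b :: l))

theorem seqCost_cons_le (a b : V) (l : List V) :
    seqCost (a :: l) ≤ dist a b + seqCost (b :: l) := by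
  cases l with
  | nil => simp [seqCost]
  | cons c l =>
    simp only [seqCost]
    linarith [dist_triangle a b c]

theorem seqCost_cons_mono {l₁ l₂ : List V} (h : l₁.Sublist l₂) :
    ∀ a, seqCost (a :: l₁) ≤ seqCost (a :: l₂) := by
  induction h with
  | slnil => exact fun _ => le_rfl
  | @cons l₁ l₂ b _ ih =>
    intro a
    have := ih b
    simp only [seqCost]
    linarith [seqCost_cons_le a b l₁]
  | cons_cons b _ ih =>
    intro a
    simp only [seqCost]
    linarith [ih b]

theorem seqCost_le_cons (a : V) (l : List V) : seqCost l ≤ seqCost (a :: l) := by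
  cases l with
  | nil => simp [seqCost]
  | cons b l =>
    simp only [seqCost]
    linarith [dist_nonneg (x := a) (y := b)]

/-- Shortcutting a walk does not make it longer. -/
theorem seqCost_mono {l₁ l₂ : List V} (h : l₁.Sublist l₂) : seqCost l₁ ≤ seqCost l₂ := by
  induction h with
  | slnil => exact le_rfl
  | cons a _ ih => exact ih.trans (seqCost_le_cons a _)
  | cons_cons a h _ => exact seqCost_cons_mono h a

theorem seqCost_append_cons (l₁ : List V) (a : V) (l₂ : List V) :
    seqCost (l₁ ++ a :: l₂) = seqCost (l₁ ++ [a]) + seqCost (a :: l₂) := by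
  induction l₁ with
  | nil => simp [seqCost]
  | cons b l₁ ih =>
    cases l₁ with
    | nil => simp [seqCost]
    | cons c l₁ =>
      simp only [List.cons_append, seqCost] at ih ⊢
      linarith

theorem seqCost_reverse (l : List V) : seqCost l.reverse = seqCost l := by
  induction l with
  | nil => rfl
  | cons a l ih =>
    cases l with
    | nil => rfl
    | cons b l =>
      rw [List.reverse_cons, List.reverse_cons, List.append_assoc, List.singleton_append,
        seqCost_append_cons, ← List.reverse_cons, ih]
      simp [seqCost, dist_comm, add_comm]

theorem dist_le_seqCost (a : V) (l : List V) (b : V) : dist a b ≤ seqCost (a :: (l ++ [b])) := by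
  have := seqCost_cons_mono (List.sublist_append_right l [b]) a
  simpa [seqCost] using this

end SeqCost

/-! ### Rooted paths and closed tours -/

namespace RootedPath

variable {V : Type*} {r : V}

theorem exists_tail (P : RootedPath r) : ∃ l, P.nodes = r :: l := by
  have := P.head_eq
  cases h : P.nodes with
  | nil => simp [h] at this
  | cons a l =>
    simp only [h, List.head?_cons, Option.some.injEq] at this
    exact ⟨l, by rw [this]⟩

theorem root_mem (P : RootedPath r) : r ∈ P.nodes := by
  obtain ⟨l, hl⟩ := P.exists_tail
  simp [hl]

/-- The path that consists of the root alone. -/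
def single (r : V) : RootedPath r := ⟨[r], rfl, List.nodup_singleton r⟩

/-- The same closed tour traversed backwards: the root comes first, and the remaining nodes follow
in reverse order. -/
def rev (P : RootedPath r) : RootedPath r where
  nodes := r :: P.nodes.tail.reverse
  head_eq := rfl
  nodup := by
    obtain ⟨l, hl⟩ := P.exists_tail
    have := P.nodup
    rw [hl] at this ⊢
    simpa using this

theorem mem_rev_nodes (P : RootedPath r) (v : V) : v ∈ P.rev.nodes ↔ v ∈ P.nodes := by
  obtain ⟨l, hl⟩ := P.exists_tail
  simp [rev, hl]

section Cost

variable [PseudoMetricSpace V]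

/-- The cost of the closed tour that follows `P` and then returns directly to the root. -/
def tourCost (P : RootedPath r) : ℝ := seqCost (P.nodes ++ [r])

theorem tourCost_rev (P : RootedPath r) : P.rev.tourCost = P.tourCost := by
  obtain ⟨l, hl⟩ := P.exists_tail
  rw [tourCost, tourCost, ← seqCost_reverse]
  simp [rev, hl]

theorem cost_le_tourCost (P : RootedPath r) : P.cost ≤ P.tourCost :=
  seqCost_mono (List.sublist_append_left _ _)

theorem cost_nonneg (P : RootedPath r) : 0 ≤ P.cost := seqCost_nonneg _

theorem tourCost_le (P : RootedPath r) : P.tourCost ≤ 2 * P.cost := by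
  obtain ⟨l, hl⟩ := P.exists_tail
  rw [tourCost, cost, hl]
  rcases List.eq_nil_or_concat l with rfl | ⟨l, z, rfl⟩
  · simp [seqCost]
  · have h1 := seqCost_append_cons (r :: l) z [r]
    have h2 := dist_le_seqCost r l z
    simp only [List.cons_append, List.append_assoc, List.nil_append, seqCost, List.concat_eq_append] at *
    rw [dist_comm] at h2
    linarith

variable [DecidableEq V]

theorem latency_eq (P : RootedPath r) {v : V} {l₁ l₂ : List V} (h : P.nodes = l₁ ++ v :: l₂) :
    P.latency v = seqCost (l₁ ++ [v]) := by
  have hn : v ∉ l₁ := by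
    have := P.nodup
    rw [h, List.nodup_append] at this
    exact fun hv => this.2.2 v hv v (by simp) rfl
  have hi : P.nodes.idxOf v = l₁.length := by
    rw [h, List.idxOf_append_of_notMem hn]
    simp
  rw [latency, hi, h]
  congr 1
  simp [List.take_append]

theorem latency_add_latency_rev (P : RootedPath r) {v : V} (hv : v ∈ P.nodes) (hr : v ≠ r) :
    P.latency v + P.rev.latency v = P.tourCost := by
  obtain ⟨l, hl⟩ := P.exists_tail
  have hvl : v ∈ l := by simpa [hl, hr] using hv
  obtain ⟨p, s, rfl⟩ := List.append_of_mem hvl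
  have h1 : P.nodes = (r :: p) ++ v :: s := by simp [hl]
  have h2 : P.rev.nodes = (r :: s.reverse) ++ v :: p.reverse := by simp [rev, hl]
  have h3 := seqCost_append_cons (r :: p) v (s ++ [r])
  have h4 := seqCost_reverse (r :: s.reverse ++ [v])
  rw [P.latency_eq h1, P.rev.latency_eq h2, tourCost, h1, ← h4]
  simp only [List.cons_append, List.append_assoc, List.reverse_cons, List.reverse_append,
    List.reverse_reverse, List.reverse_nil, List.nil_append] at h3 ⊢
  exact h3.symm

/-- The rest of the path leads from `v` to the end of the path, so its cost is at least the
distance from the root to the end minus that to `v`. -/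
theorem latency_le (P : RootedPath r) {v : V} (hv : v ∈ P.nodes) :
    P.latency v ≤ P.cost - (P.tourCost - P.cost) + dist r v := by
  obtain ⟨p, s, h⟩ := List.append_of_mem hv
  rw [P.latency_eq h, tourCost, cost, h, List.append_assoc, List.cons_append,
    seqCost_append_cons p v s, seqCost_append_cons p v (s ++ [r])]
  -- It remains to bound the closing edge by the cost from `v` to the end plus `dist r v`.
  have key : seqCost (v :: (s ++ [r])) ≤ 2 * seqCost (v :: s) + dist r v := by
    rcases List.eq_nil_or_concat s with rfl | ⟨s, z, rfl⟩
    · simp [seqCost, dist_comm]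
    · have h1 := seqCost_append_cons (v :: s) z [r]
      have h2 := dist_le_seqCost v s z
      simp only [List.cons_append, List.append_assoc, List.nil_append, seqCost,
        List.concat_eq_append] at *
      linarith [dist_triangle z v r, dist_comm z v, dist_comm r v]
  linarith

/-- Appending to `Q` the nodes of `W` that belong to a set `A` of unvisited nodes costs, for each
of these nodes, at most the closed tour `Q` plus its latency on `W`. -/
theorem exists_extend (Q W : RootedPath r) (A : Finset V) (hA : A ⊆ W.nodes.toFinset)
    (hd : ∀ v ∈ A, v ∉ Q.nodes) :
    ∃ Q' : RootedPath r, Q'.nodes.toFinset = Q.nodes.toFinset ∪ A ∧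
      Q'.tourCost ≤ Q.tourCost + W.tourCost ∧ (∀ v ∈ Q.nodes, Q'.latency v = Q.latency v) ∧
      ∀ v ∈ A, Q'.latency v ≤ Q.tourCost + W.latency v := by
  have hAW : ∀ v ∈ A, v ∈ W.nodes := fun v hv => List.mem_toFinset.1 (hA hv)
  refine ⟨⟨Q.nodes ++ W.nodes.filter (· ∈ A), ?_, ?_⟩, ?_, ?_, ?_, ?_⟩
  · obtain ⟨l, hl⟩ := Q.exists_tail
    simp [hl]
  · rw [List.nodup_append]
    refine ⟨Q.nodup, W.nodup.filter _, ?_⟩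
    rintro a ha b hb rfl
    exact hd a (by simpa using (List.mem_filter.1 hb).2) ha
  · ext v
    simp only [List.toFinset_append, mem_union, List.mem_toFinset, List.mem_filter,
      decide_eq_true_eq]
    exact or_congr_right ⟨fun h => h.2, fun h => ⟨hAW v h, h⟩⟩
  · obtain ⟨l, hl⟩ := W.exists_tail
    have h1 := seqCost_append_cons Q.nodes r (l ++ [r])
    have h2 : seqCost (Q.nodes ++ (W.nodes.filter (· ∈ A) ++ [r]))
        ≤ seqCost (Q.nodes ++ (W.nodes ++ [r])) :=
      seqCost_mono (List.filter_sublist.append_right _ |>.append_left _)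
    simp only [tourCost, List.append_assoc]
    rw [hl] at h2 ⊢
    exact h2.trans h1.le
  · intro v hv
    obtain ⟨p, s, h⟩ := List.append_of_mem hv
    rw [Q.latency_eq h]
    exact latency_eq _ (l₂ := s ++ W.nodes.filter (· ∈ A)) (by simp [h])
  · intro v hv
    obtain ⟨p, s, h⟩ := List.append_of_mem (hAW v hv)
    rw [W.latency_eq h, latency_eq (v := v) (l₁ := Q.nodes ++ p.filter (· ∈ A))
      (l₂ := s.filter (· ∈ A)) _ (by simp [h, hv])]
    obtain ⟨l, hl⟩ : ∃ l, p ++ [v] = r :: l := by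
      obtain ⟨l, hl⟩ := W.exists_tail
      cases p with
      | nil =>
        refine ⟨[], ?_⟩
        rw [h] at hl
        simpa using (List.cons.inj hl).1
      | cons a p =>
        rw [h] at hl
        exact ⟨p ++ [v], by simpa using (List.cons.inj hl).1⟩
    have h2 : seqCost (Q.nodes ++ (p.filter (· ∈ A) ++ [v])) ≤ seqCost (Q.nodes ++ (p ++ [v])) :=
      seqCost_mono (List.filter_sublist.append_right _ |>.append_left _)
    rw [List.append_assoc]
    refine h2.trans ?_
    rw [hl, seqCost_append_cons]
    exact le_rfl

end Cost

end RootedPath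

/-! ### Sorted sums and logarithmic averages -/

/-- If at least `l` elements have `f`-value at most `b l`, for every `l ≤ #s`, then `b` dominates
the sorted values of `f` term by term. -/
theorem sum_le_sum_of_le_card_filter {V : Type*} [DecidableEq V] (f : V → ℝ) (b : ℕ → ℝ)
    (s : Finset V) (h : ∀ l ∈ Icc 1 #s, l ≤ #{v ∈ s | f v ≤ b l}) :
    ∑ v ∈ s, f v ≤ ∑ l ∈ Icc 1 #s, b l := by
  induction hn : #s generalizing s with
  | zero => simp [card_eq_zero.1 hn]
  | succ n ih =>
    have hne : s.Nonempty := card_pos.1 (by omega)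
    obtain ⟨v, hv, hmax⟩ := s.exists_max_image f hne
    have hall : ∀ {t}, f v ≤ t → ({u ∈ s | f u ≤ t} : Finset V) = s := fun ht =>
      filter_true_of_mem fun u hu => (hmax u hu).trans ht
    have hcard : #(s.erase v) = n := by rw [card_erase_of_mem hv, hn]; rfl
    have hfv : f v ≤ b (n + 1) := by
      have h1 := h (n + 1) (by simp [hn])
      have h2 := eq_of_subset_of_card_le (filter_subset (fun u => f u ≤ b (n + 1)) s) (by omega)
      rw [← h2] at hv
      exact (mem_filter.1 hv).2
    have := ih (s.erase v) (fun l hl => ?_) hcard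
    · rw [← add_sum_erase s f hv, sum_Icc_succ_top (by omega)]
      linarith
    · rw [hcard, mem_Icc] at hl
      by_cases hvl : f v ≤ b l
      · rw [filter_erase, hall hvl, hcard]
        exact hl.2
      · rw [filter_erase, erase_eq_of_notMem (by simp [hvl])]
        exact h l (by rw [hn, mem_Icc]; omega)

/-- Averaging over the geometric sequences `n v, n v / c, n v / c², …` with `1 / c ≤ v ≤ 1`, with
respect to the measure `dv / v`: the intervals that the terms sweep out tile `(0, n]`. -/
theorem mul_log_le_of_forall_le_sum {g : ℝ → ℝ} (hg : Antitone g) (hg0 : ∀ y, 0 ≤ g y)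
    {c X K : ℝ} (hc : 1 < c) (hK : 0 ≤ K) (n L : ℕ)
    (h : ∀ v ∈ Set.Icc c⁻¹ 1,
      X ≤ K * ∑ i ∈ range L, g (n / c ^ i * v) * (n / c ^ i * v)) :
    X * Real.log c ≤ K * ∑ k ∈ range n, g k := by
  have hc0 : 0 < c := one_pos.trans hc
  have hc1 : c⁻¹ ≤ 1 := inv_le_one_of_one_le₀ hc.le
  have hci : 0 < c⁻¹ := inv_pos.2 hc0
  have hint : ∀ a b : ℝ, IntervalIntegrable g MeasureTheory.volume a b := fun a b =>
    hg.intervalIntegrable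
  have hint' : ∀ i, IntervalIntegrable (fun v => n / c ^ i * g (n / c ^ i * v))
      MeasureTheory.volume c⁻¹ 1 := fun i => by
    refine IntervalIntegrable.const_mul (Antitone.intervalIntegrable fun x y hxy => ?_) _
    exact hg (mul_le_mul_of_nonneg_left hxy (by positivity))
  have hleft : ∫ v in c⁻¹..1, X * v⁻¹ = X * Real.log c := by
    rw [intervalIntegral.integral_const_mul, integral_inv_of_pos hci one_pos]
    simp
  have hright : ∫ v in c⁻¹..1, K * ∑ i ∈ range L, n / c ^ i * g (n / c ^ i * v)
      = K * ∫ y in (n / c ^ L)..n, g y := by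
    rw [intervalIntegral.integral_const_mul,
      intervalIntegral.integral_finsetSum fun i _ => hint' i]
    congr 1
    have h1 : ∀ i, ∫ v in c⁻¹..1, n / c ^ i * g (n / c ^ i * v)
        = - ∫ y in (n / c ^ i)..(n / c ^ (i + 1)), g y := fun i => by
      rw [intervalIntegral.integral_const_mul, intervalIntegral.mul_integral_comp_mul_left,
        intervalIntegral.integral_symm, neg_inj]
      congr 1
      · rw [mul_one]
      · rw [pow_succ, div_mul_eq_div_div, div_eq_mul_inv _ c]
    rw [sum_congr rfl fun i _ => h1 i, sum_neg_distrib,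
      intervalIntegral.sum_integral_adjacent_intervals fun i _ => hint _ _,
      ← intervalIntegral.integral_symm]
    simp
  have hmono : ∫ v in c⁻¹..1, X * v⁻¹
      ≤ ∫ v in c⁻¹..1, K * ∑ i ∈ range L, n / c ^ i * g (n / c ^ i * v) := by
    refine intervalIntegral.integral_mono_on hc1 ?_ ?_ fun v hv => ?_
    · refine (ContinuousOn.intervalIntegrable ?_)
      rw [Set.uIcc_of_le hc1]
      exact continuousOn_const.mul (continuousOn_id.inv₀ fun x hx => (hci.trans_le hx.1).ne')
    · refine IntervalIntegrable.const_mul ?_ K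
      simpa only [Finset.sum_fn] using IntervalIntegrable.sum (range L) fun i _ => hint' i
    · have hv0 : 0 < v := hci.trans_le hv.1
      rw [← div_eq_mul_inv, div_le_iff₀ hv0]
      refine (h v hv).trans_eq ?_
      rw [mul_assoc, sum_mul]
      congr 1
      exact sum_congr rfl fun i _ => by ring
  have hsub : ∫ y in (n / c ^ L)..n, g y ≤ ∫ y in (0 : ℝ)..n, g y := by
    rw [← intervalIntegral.integral_add_adjacent_intervals (hint 0 (n / c ^ L)) (hint _ _)]
    have : 0 ≤ ∫ y in (0 : ℝ)..(n / c ^ L), g y :=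
      intervalIntegral.integral_nonneg (by positivity) fun y _ => hg0 y
    linarith
  have hsum : ∫ y in (0 : ℝ)..n, g y ≤ ∑ k ∈ range n, g k := by
    have := (hg.antitoneOn (Set.Icc (0 : ℝ) (0 + n))).integral_le_sum
    simpa using this
  rw [← hleft]
  refine hmono.trans (hright.le.trans ?_)
  exact mul_le_mul_of_nonneg_left (hsub.trans hsum) hK

/-! ### Concatenating closed tours -/

section Rounds

variable {V : Type*} {k : ℕ} {r : Fin k → V}

theorem PathFamily.mem_covered [DecidableEq V] {P : PathFamily r} {v : V} :
    v ∈ P.covered ↔ ∃ j, v ∈ (P j).nodes := by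
  simp [PathFamily.covered]

variable [PseudoMetricSpace V]

theorem PathFamily.bottleneck_nonneg (P : PathFamily r) : 0 ≤ P.bottleneck :=
  Real.iSup_nonneg fun j => (P j).cost_nonneg

theorem PathFamily.cost_le_bottleneck (P : PathFamily r) (j : Fin k) : (P j).cost ≤ P.bottleneck :=
  le_ciSup (f := fun i => (P i).cost) (Set.finite_range _).bddAbove j

variable [DecidableEq V]

/-- `W` can serve new nodes with latency budgets `φ` by closed tours of cost at most `T`: whichever
set `A` of nodes of `W j` is still to be served, the tour along `W j` can be oriented such that
the latencies of the nodes in `A` sum to at most the total budget of `A`. -/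
def PathFamily.Serves (W : PathFamily r) (T : ℝ) (φ : V → ℝ) : Prop :=
  ∀ j, ∀ A ⊆ (W j).nodes.toFinset, r j ∉ A → ∃ Q : RootedPath (r j),
    A ⊆ Q.nodes.toFinset ∧ Q.tourCost ≤ T ∧ ∑ v ∈ A, Q.latency v ≤ ∑ v ∈ A, φ v

/-- The better of the two orientations has average latency at most half of the tour cost. -/
theorem PathFamily.serves_half (W : PathFamily r) {T : ℝ} (hT : ∀ j, (W j).tourCost ≤ T) :
    W.Serves T fun _ => T / 2 := by
  intro j A hA hr
  have hsum : ∑ v ∈ A, (W j).latency v + ∑ v ∈ A, (W j).rev.latency v ≤ 2 * ∑ v ∈ A, T / 2 := by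
    rw [← sum_add_distrib, mul_sum]
    refine sum_le_sum fun v hv => ?_
    rw [(W j).latency_add_latency_rev (List.mem_toFinset.1 (hA hv)) fun h => hr (h ▸ hv)]
    linarith [hT j]
  rcases le_total (∑ v ∈ A, (W j).latency v) (∑ v ∈ A, (W j).rev.latency v) with h | h
  · exact ⟨W j, hA, hT j, by linarith⟩
  · refine ⟨(W j).rev, fun v hv => ?_, (W j).tourCost_rev.trans_le (hT j), by linarith⟩
    rw [List.mem_toFinset, RootedPath.mem_rev_nodes]
    exact List.mem_toFinset.1 (hA hv)

/-- The forward orientation of a single path: by `RootedPath.latency_le`, a node is served at most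
`b - d` later than its distance from the root, where `b` is the cost of the path and `d` the
distance from its end to the root. -/
theorem PathFamily.serves_forward {r : Fin 1 → V} (W : PathFamily r) :
    W.Serves (W 0).tourCost
      fun v => ((W 0).cost - ((W 0).tourCost - (W 0).cost)) + dist (r 0) v := by
  intro j A hA _
  obtain rfl : j = 0 := Subsingleton.elim _ _
  exact ⟨W 0, hA, le_rfl, sum_le_sum fun v hv => (W 0).latency_le (List.mem_toFinset.1 (hA hv))⟩

/-- One round: every vehicle, back at its depot at time at most `τ`, serves new nodes. -/
theorem PathFamily.exists_round (P W : PathFamily r) {τ T : ℝ} {φ : V → ℝ}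
    (hP : ∀ j, (P j).tourCost ≤ τ) (hW : W.Serves T φ) :
    ∃ P' : PathFamily r, P'.covered = P.covered ∪ W.covered ∧ (∀ j, (P' j).tourCost ≤ τ + T) ∧
      P'.totalLatency ≤ P.totalLatency + ∑ v ∈ P'.covered \ P.covered, (τ + φ v) := by
  -- Each new node is assigned to one of the paths that visit it.
  have hex : ∀ v, ∃ j : Option (Fin k), v ∈ W.covered → ∃ i, j = some i ∧ v ∈ (W i).nodes := by
    intro v
    by_cases hv : v ∈ W.covered
    · obtain ⟨i, hi⟩ := PathFamily.mem_covered.1 hv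
      exact ⟨some i, fun _ => ⟨i, rfl, hi⟩⟩
    · exact ⟨none, fun h => absurd h hv⟩
  choose σ hσ using hex
  let A : Fin k → Finset V := fun j => {v ∈ W.covered \ P.covered | σ v = some j}
  have hA : ∀ {j v}, v ∈ A j ↔ (v ∈ W.covered ∧ v ∉ P.covered) ∧ σ v = some j := by
    intro j v
    simp only [A, mem_filter, mem_sdiff]
  have hAW : ∀ j, A j ⊆ (W j).nodes.toFinset := by
    intro j v hv
    obtain ⟨⟨h1, -⟩, h2⟩ := hA.1 hv
    obtain ⟨i, hi, hvi⟩ := hσ v h1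
    rw [h2, Option.some.injEq] at hi
    rw [List.mem_toFinset, hi]
    exact hvi
  have hAP : ∀ j, ∀ v ∈ A j, v ∉ (P j).nodes := fun j v hv hvP =>
    (hA.1 hv).1.2 (PathFamily.mem_covered.2 ⟨j, hvP⟩)
  have hrA : ∀ j, r j ∉ A j := fun j hj => hAP j _ hj (P j).root_mem
  choose Q hQA hQT hQφ using fun j => hW j (A j) (hAW j) (hrA j)
  choose P' hcov hcost hold hnew using fun j => (P j).exists_extend (Q j) (A j) (hQA j) (hAP j)
  have hbU : univ.biUnion A = W.covered \ P.covered := by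
    ext v
    simp only [mem_biUnion, mem_univ, true_and, hA, mem_sdiff]
    refine ⟨fun ⟨_, h, _⟩ => h, fun h => ?_⟩
    obtain ⟨i, hi, -⟩ := hσ v h.1
    exact ⟨i, h, hi⟩
  have hc : PathFamily.covered P' = P.covered ∪ W.covered := by
    rw [← union_sdiff_self_eq_union, ← hbU]
    ext v
    simp only [PathFamily.covered, hcov, mem_biUnion, mem_univ, true_and, mem_union, exists_or]
  refine ⟨P', hc, fun j => (hcost j).trans (add_le_add (hP j) (hQT j)), ?_⟩
  have hdisj : ∀ j, Disjoint ((P j).nodes.toFinset.erase (r j)) (A j) := fun j =>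
    disjoint_left.2 fun v hv hvA => hAP j v hvA (List.mem_toFinset.1 (mem_of_mem_erase hv))
  have hpd : (↑(univ : Finset (Fin k)) : Set (Fin k)).PairwiseDisjoint A := by
    intro i _ j _ hij
    refine disjoint_left.2 fun v hi hj => hij ?_
    exact Option.some.inj ((hA.1 hi).2.symm.trans (hA.1 hj).2)
  rw [hc, union_sdiff_left, ← hbU, sum_biUnion hpd, PathFamily.totalLatency,
    PathFamily.totalLatency, ← sum_add_distrib]
  refine sum_le_sum fun j _ => ?_
  rw [hcov j, erase_union_distrib, erase_eq_of_notMem (hrA j), sum_union (hdisj j)]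
  refine add_le_add (sum_le_sum fun v hv => ?_) ?_
  · exact (hold j v (List.mem_toFinset.1 (mem_of_mem_erase hv))).le
  · refine (sum_le_sum fun v hv => hnew j v hv).trans ?_
    rw [sum_add_distrib, sum_add_distrib]
    exact add_le_add (sum_le_sum fun _ _ => hP j) (hQφ j)

/-- Concatenating rounds. The sequence `ρ` bounds the numbers of nodes not yet visited. Writing the
cost of a round as `a` per unvisited node before it and `T - a` per unvisited node after it makes
it monotone in these numbers. -/
theorem PathFamily.exists_concat [Fintype V] (r : Fin k → V) (W : ℕ → PathFamily r) {T a : ℕ → ℝ}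
    {δ : V → ℝ} {ρ : ℕ → ℝ} (L : ℕ) (hW : ∀ i < L, (W i).Serves (T i) fun v => a i + δ v)
    (ha : ∀ i < L, 0 ≤ a i ∧ a i ≤ T i) (hδ : ∀ v, 0 ≤ δ v) (hρ0 : Fintype.card V ≤ ρ 0)
    (hρ : ∀ i < L, Fintype.card V - #(W i).covered ≤ ρ (i + 1)) :
    ∃ P : PathFamily r, (∀ i < L, (W i).covered ⊆ P.covered) ∧
      P.totalLatency ≤ ∑ i ∈ range L, (a i * ρ i + (T i - a i) * ρ (i + 1)) + ∑ v, δ v := by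
  suffices H : ∃ P : PathFamily r, ∃ τ : ℝ, 0 ≤ τ ∧ (∀ j, (P j).tourCost ≤ τ) ∧
      (∀ i < L, (W i).covered ⊆ P.covered) ∧ Fintype.card V - #P.covered ≤ ρ L ∧
      P.totalLatency + τ * (Fintype.card V - #P.covered)
        ≤ ∑ i ∈ range L, (a i * ρ i + (T i - a i) * ρ (i + 1)) + ∑ v ∈ P.covered, δ v by
    obtain ⟨P, τ, hτ, -, hcov, -, hlat⟩ := H
    refine ⟨P, hcov, ?_⟩
    have h1 : (#P.covered : ℝ) ≤ Fintype.card V := by exact_mod_cast card_le_univ _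
    have h2 : ∑ v ∈ P.covered, δ v ≤ ∑ v, δ v :=
      sum_le_sum_of_subset_of_nonneg (subset_univ _) fun v _ _ => hδ v
    have h3 := mul_nonneg hτ (sub_nonneg.2 h1)
    linarith
  induction L with
  | zero =>
    refine ⟨fun j => RootedPath.single (r j), 0, le_rfl, fun j => ?_, by simp, ?_, ?_⟩
    · simp [RootedPath.tourCost, RootedPath.single, seqCost]
    · exact (sub_le_self _ (Nat.cast_nonneg _)).trans hρ0
    · have : PathFamily.totalLatency (fun j => RootedPath.single (r j)) = 0 := by
        simp [PathFamily.totalLatency, RootedPath.single]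
      rw [this]
      simpa using sum_nonneg fun v _ => hδ v
  | succ L ih =>
    obtain ⟨P, τ, hτ, hP, hcov, hle, hlat⟩ := ih (fun i hi => hW i (by omega))
      (fun i hi => ha i (by omega)) (fun i hi => hρ i (by omega))
    obtain ⟨P', hc, hP', hlat'⟩ := P.exists_round (W L) hP (hW L (by omega))
    have hsub : P.covered ⊆ P'.covered := hc ▸ subset_union_left
    have hsubW : (W L).covered ⊆ P'.covered := hc ▸ subset_union_right
    obtain ⟨ha0, haT⟩ := ha L (by omega)
    have hle' : (Fintype.card V : ℝ) - #P'.covered ≤ ρ (L + 1) := by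
      refine le_trans ?_ (hρ L (by omega))
      have : (#(W L).covered : ℝ) ≤ #P'.covered := by exact_mod_cast card_le_card hsubW
      linarith
    refine ⟨P', τ + T L, by linarith, hP', fun i hi => ?_, hle', ?_⟩
    · rcases Nat.lt_succ_iff_lt_or_eq.1 hi with h | rfl
      · exact (hcov i h).trans hsub
      · exact hsubW
    · have hnew : ∑ v ∈ P'.covered \ P.covered, (τ + (a L + δ v))
          = (#P'.covered - #P.covered : ℝ) * (τ + a L)
            + (∑ v ∈ P'.covered, δ v - ∑ v ∈ P.covered, δ v) := by
        rw [sum_add_distrib, sum_add_distrib, sum_const, sum_const, card_sdiff_of_subset hsub,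
          nsmul_eq_mul, nsmul_eq_mul, Nat.cast_sub (card_le_card hsub), ← sum_sdiff hsub]
        ring
      rw [sum_range_succ]
      have h1 := mul_le_mul_of_nonneg_left hle ha0
      have h2 := mul_le_mul_of_nonneg_left hle' (sub_nonneg.2 haT)
      linarith

/-! ### Properties of the bottleneck-stroll values -/

section OptBNS

variable [Fintype V]

theorem exists_optBNS (hk : 0 < k) (r : Fin k → V) {l : ℕ} (hl : l ≤ Fintype.card V) :
    ∃ W : PathFamily r, l ≤ #W.covered ∧ W.bottleneck = optBNS r l :=
  (isLeast_optBNS hk r hl).1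

theorem optBNS_nonneg (hk : 0 < k) (r : Fin k → V) {l : ℕ} (hl : l ≤ Fintype.card V) :
    0 ≤ optBNS r l := by
  obtain ⟨W, -, hW⟩ := exists_optBNS hk r hl
  exact hW ▸ W.bottleneck_nonneg

theorem optBNS_mono (hk : 0 < k) (r : Fin k → V) {l m : ℕ} (hlm : l ≤ m)
    (hm : m ≤ Fintype.card V) : optBNS r l ≤ optBNS r m := by
  obtain ⟨W, hc, hW⟩ := exists_optBNS hk r hm
  exact (isLeast_optBNS hk r (hlm.trans hm)).2 ⟨W, hlm.trans hc, hW⟩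

theorem bnslb_eq (r : Fin k → V) :
    bnslb r = ∑ i ∈ range (Fintype.card V), optBNS r (Fintype.card V - i) := by
  rw [bnslb, ← sum_range_reflect]
  refine sum_bij' (fun l _ => l - 1) (fun i _ => i + 1) ?_ ?_ ?_ ?_ ?_ <;>
    simp only [mem_Icc, mem_range] <;> intros <;> first | omega | skip
  congr 1
  omega

/-- At least `l` nodes lie within distance `optBNS r l` of the root, namely those of an optimal
stroll, so the sorted distances are dominated by the stroll values. -/
theorem sum_dist_le_bnslb (r : Fin 1 → V) : ∑ v, dist (r 0) v ≤ bnslb r := by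
  refine sum_le_sum_of_le_card_filter (fun v => dist (r 0) v) (optBNS r) univ fun l hl => ?_
  obtain ⟨W, hc, hW⟩ := exists_optBNS one_pos r (mem_Icc.1 hl).2
  refine hc.trans (card_le_card fun v hv => ?_)
  obtain ⟨j, hj⟩ := PathFamily.mem_covered.1 hv
  obtain rfl : j = 0 := Subsingleton.elim _ _
  rw [mem_filter, ← hW]
  refine ⟨mem_univ v, le_trans ?_ (W.cost_le_bottleneck 0)⟩
  obtain ⟨t, ht⟩ := (W 0).exists_tail
  rw [RootedPath.cost, ht]
  rw [ht, List.mem_cons] at hj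
  rcases hj with rfl | hj
  · simpa using seqCost_nonneg _
  · have := seqCost_cons_mono (List.singleton_sublist.2 hj) (r 0)
    simpa [seqCost] using this

end OptBNS

end Rounds

/-! ### The approximation factors -/

section Bounds

variable {V : Type*} [Fintype V] [DecidableEq V] [PseudoMetricSpace V] {k : ℕ}

theorem exists_optimal (hk : 0 < k) (r : Fin k → V) :
    ∃ P : PathFamily r, P.IsFeasible ∧
      ∀ Q : PathFamily r, Q.IsFeasible → P.totalLatency ≤ Q.totalLatency := by
  have hne : Nonempty {P : PathFamily r // P.IsFeasible} := by
    choose P hP using fun i => exists_spanning (r i)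
    exact ⟨P, fun v => PathFamily.mem_covered.2 ⟨⟨0, hk⟩, hP _ v⟩⟩
  obtain ⟨P, hP⟩ :=
    Finite.exists_min fun P : {P : PathFamily r // P.IsFeasible} => P.1.totalLatency
  exact ⟨P.1, P.2, fun Q hQ => hP ⟨Q, hQ⟩⟩

/-- The solution built from rounds after which at most `n v / c ^ i` nodes are left, for
`i = 0, 1, …, L`, where `n` is the number of all nodes. As `1 ≤ c * v`, the number
`⌊c * (n v / c ^ i)⌋₊` bounds what is left before round `i`, including `i = 0`. -/
theorem exists_feasible_le_sum (r : Fin k → V) {c v : ℝ} {L : ℕ} (hc : 1 < c)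
    (hL : Fintype.card V < c ^ L) (hv : v ∈ Set.Icc c⁻¹ 1) (W : ℕ → PathFamily r) {T a : ℕ → ℝ}
    {δ : V → ℝ} (hcov : ∀ i, Fintype.card V - ⌊Fintype.card V / c ^ i * v⌋₊ ≤ #(W i).covered)
    (hW : ∀ i, (W i).Serves (T i) fun v => a i + δ v) (ha : ∀ i, 0 ≤ a i ∧ a i ≤ T i)
    (hδ : ∀ v, 0 ≤ δ v) :
    ∃ P : PathFamily r, P.IsFeasible ∧
      P.totalLatency ≤ ∑ i ∈ range (L + 1), (a i * ⌊c * (Fintype.card V / c ^ i * v)⌋₊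
        + (T i - a i) * ⌊Fintype.card V / c ^ i * v⌋₊) + ∑ v, δ v := by
  have hc0 : 0 < c := one_pos.trans hc
  have hshift : ∀ i, c * (Fintype.card V / c ^ (i + 1) * v) = Fintype.card V / c ^ i * v := by
    intro i
    rw [pow_succ]
    field_simp
  have hρ0 : (Fintype.card V : ℝ) ≤ ⌊c * (Fintype.card V / c ^ 0 * v)⌋₊ := by
    have h1 : (1 : ℝ) ≤ c * v := by
      have := mul_le_mul_of_nonneg_left hv.1 hc0.le
      rwa [mul_inv_cancel₀ hc0.ne'] at this
    refine Nat.cast_le.2 (Nat.le_floor ?_)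
    have : (0 : ℝ) ≤ Fintype.card V := Nat.cast_nonneg _
    simp only [pow_zero, div_one]
    nlinarith
  have hρ : ∀ i < L + 1, (Fintype.card V : ℝ) - #(W i).covered
      ≤ ⌊c * (Fintype.card V / c ^ (i + 1) * v)⌋₊ := by
    intro i _
    have h1 := hcov i
    have h2 : Fintype.card V ≤ ⌊Fintype.card V / c ^ i * v⌋₊ + #(W i).covered := by omega
    have h3 : (Fintype.card V : ℝ) ≤ ⌊Fintype.card V / c ^ i * v⌋₊ + #(W i).covered := by
      exact_mod_cast h2
    rw [hshift]
    linarith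
  obtain ⟨P, hP, hlat⟩ := PathFamily.exists_concat r W (δ := δ) (L := L + 1)
    (ρ := fun i => ⌊c * (Fintype.card V / c ^ i * v)⌋₊) (fun i _ => hW i) (fun i _ => ha i) hδ
    hρ0 hρ
  refine ⟨P, fun w => hP L (by omega) ?_, by simpa only [hshift] using hlat⟩
  -- Fewer than one node is left after the last round.
  have h1 : (Fintype.card V : ℝ) / c ^ L * v < 1 := by
    have h2 : (Fintype.card V : ℝ) / c ^ L < 1 := (div_lt_one (by positivity)).2 hL
    have h3 : (0 : ℝ) ≤ Fintype.card V / c ^ L := by positivity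
    nlinarith [hv.2]
  have h2 := hcov L
  rw [Nat.floor_eq_zero.2 h1, Nat.sub_zero] at h2
  rw [(card_eq_iff_eq_univ _).1 (le_antisymm (card_le_univ _) h2)]
  exact mem_univ w

/-- If an amount `X` is bounded, for all geometric sequences of numbers of remaining nodes, by
`K` times the sum of remaining numbers times stroll values, then averaging bounds it by the
lower bound. -/
theorem mul_log_le_of_forall_le_sum_optBNS (hk : 0 < k) (r : Fin k → V) {c X K : ℝ} {L : ℕ}
    (hc : 1 < c) (hK : 0 ≤ K)
    (h : ∀ v ∈ Set.Icc c⁻¹ 1, X ≤ K * ∑ i ∈ range L,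
      optBNS r (Fintype.card V - ⌊Fintype.card V / c ^ i * v⌋₊) * (Fintype.card V / c ^ i * v)) :
    X * Real.log c ≤ K * bnslb r := by
  have := mul_log_le_of_forall_le_sum (g := fun y => optBNS r (Fintype.card V - ⌊y⌋₊))
    (fun x y hxy => optBNS_mono hk r (Nat.sub_le_sub_left (Nat.floor_mono hxy) _)
      (Nat.sub_le _ _)) (fun y => optBNS_nonneg hk r (Nat.sub_le _ _)) hc hK
    (Fintype.card V) L h
  simpa only [Nat.floor_natCast, ← bnslb_eq] using this

/-- Balanced rounds: going back along the path closes a tour of cost at most `2 * b`, so a round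
costs at most `b` per node left before it and `b` per node left after it. The resulting factor
`(c + 1) / log c` equals `muStar` for `c = muStar`. -/
theorem exists_totalLatency_le_muStar (hk : 0 < k) (r : Fin k → V) :
    ∃ P : PathFamily r, P.IsFeasible ∧ P.totalLatency ≤ muStar * bnslb r := by
  obtain ⟨P, hP, hopt⟩ := exists_optimal hk r
  refine ⟨P, hP, ?_⟩
  obtain ⟨hμ0, hμ⟩ := muStar_spec
  have hlog : 0 < Real.log muStar := pos_of_mul_pos_right (by rw [hμ]; linarith) hμ0.le
  have hμ1 : 1 < muStar := (Real.log_pos_iff hμ0.le).1 hlog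
  obtain ⟨L, hL⟩ := pow_unbounded_of_one_lt (Fintype.card V : ℝ) hμ1
  have key : P.totalLatency * Real.log muStar ≤ (muStar + 1) * bnslb r := by
    refine mul_log_le_of_forall_le_sum_optBNS (L := L + 1) hk r hμ1 (by linarith) fun v hv => ?_
    choose W hcov hW using fun i : ℕ => exists_optBNS hk r
      (Nat.sub_le (Fintype.card V) ⌊Fintype.card V / muStar ^ i * v⌋₊)
    have hW0 : ∀ i, 0 ≤ (W i).bottleneck := fun i => (W i).bottleneck_nonneg
    obtain ⟨Q, hQ, hlat⟩ := exists_feasible_le_sum r hμ1 hL hv W (δ := 0)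
      (T := fun i => 2 * (W i).bottleneck) (a := fun i => 2 * (W i).bottleneck / 2) hcov
      (fun i => by
        simpa using (W i).serves_half fun j => ((W i j).tourCost_le).trans
          (mul_le_mul_of_nonneg_left ((W i).cost_le_bottleneck j) two_pos.le))
      (fun i => by constructor <;> linarith [hW0 i]) (fun _ => le_rfl)
    refine (hopt Q hQ).trans (hlat.trans ?_)
    rw [mul_sum]
    simp only [Pi.zero_apply, sum_const_zero, add_zero]
    refine sum_le_sum fun i _ => ?_
    rw [← hW i]
    have hv0 : 0 ≤ v := (inv_nonneg.2 hμ0.le).trans hv.1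
    have hx : 0 ≤ Fintype.card V / muStar ^ i * v := by positivity
    have h1 := mul_le_mul_of_nonneg_left (Nat.floor_le hx) (hW0 i)
    have h2 := mul_le_mul_of_nonneg_left (Nat.floor_le (mul_nonneg hμ0.le hx)) (hW0 i)
    linarith
  rw [← hμ, mul_right_comm] at key
  exact le_of_mul_le_mul_right key hlog

/-- An optimal solution costs at most `4 / 9` times the bound from balanced rounds plus `5 / 9`
times the bound from forward rounds, on the same strolls. With `c = 4` these weights make the
return edges drop out, which leaves the factor `5 / 9 + (10 / 3) / log 4 < 2.961`. -/
theorem exists_totalLatency_le_of_single (r : Fin 1 → V) :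
    ∃ P : PathFamily r, P.IsFeasible ∧ P.totalLatency ≤ 3.03 * bnslb r := by
  obtain ⟨P, hP, hopt⟩ := exists_optimal one_pos r
  refine ⟨P, hP, ?_⟩
  obtain ⟨L, hL⟩ := pow_unbounded_of_one_lt (Fintype.card V : ℝ) (show (1 : ℝ) < 4 by norm_num)
  have hB : 0 ≤ bnslb r := sum_nonneg fun l hl => optBNS_nonneg one_pos r (mem_Icc.1 hl).2
  have key : (P.totalLatency - 5 / 9 * bnslb r) * Real.log 4 ≤ 10 / 3 * bnslb r := by
    refine mul_log_le_of_forall_le_sum_optBNS (L := L + 1) one_pos r (by norm_num) (by norm_num)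
      fun v hv => ?_
    choose W hcov hW using fun i : ℕ => exists_optBNS one_pos r
      (Nat.sub_le (Fintype.card V) ⌊Fintype.card V / (4 : ℝ) ^ i * v⌋₊)
    have hb : ∀ i, (W i 0).cost = (W i).bottleneck := fun i => by
      simp [PathFamily.bottleneck]
    have hT1 : ∀ i, (W i 0).cost ≤ (W i 0).tourCost := fun i => (W i 0).cost_le_tourCost
    have hT2 : ∀ i, (W i 0).tourCost ≤ 2 * (W i 0).cost := fun i => (W i 0).tourCost_le
    have hb0 : ∀ i, 0 ≤ (W i 0).cost := fun i => (W i 0).cost_nonneg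
    obtain ⟨Q₁, hQ₁, hlat₁⟩ := exists_feasible_le_sum r (by norm_num) hL hv W (δ := 0)
      (T := fun i => (W i 0).tourCost) (a := fun i => (W i 0).tourCost / 2) hcov
      (fun i => by
        simpa using (W i).serves_half (T := (W i 0).tourCost) fun j => by
          rw [Subsingleton.elim j 0])
      (fun i => by constructor <;> linarith [hT1 i, hb0 i]) (fun _ => le_rfl)
    obtain ⟨Q₂, hQ₂, hlat₂⟩ := exists_feasible_le_sum r (by norm_num) hL hv W
      (δ := fun v => dist (r 0) v) (T := fun i => (W i 0).tourCost)
      (a := fun i => (W i 0).cost - ((W i 0).tourCost - (W i 0).cost)) hcov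
      (fun i => (W i).serves_forward)
      (fun i => by constructor <;> linarith [hT1 i, hT2 i]) (fun _ => dist_nonneg)
    have h1 := (hopt Q₁ hQ₁).trans hlat₁
    have h2 := (hopt Q₂ hQ₂).trans hlat₂
    have h3 := sum_dist_le_bnslb r
    simp only [Pi.zero_apply, sum_const_zero, add_zero] at h1
    have h4 : P.totalLatency - 5 / 9 * bnslb r
        ≤ ∑ i ∈ range (L + 1), (4 / 9 * ((W i 0).tourCost / 2
              * ⌊(4 : ℝ) * (Fintype.card V / 4 ^ i * v)⌋₊
            + ((W i 0).tourCost - (W i 0).tourCost / 2) * ⌊Fintype.card V / (4 : ℝ) ^ i * v⌋₊)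
          + 5 / 9 * (((W i 0).cost - ((W i 0).tourCost - (W i 0).cost))
              * ⌊(4 : ℝ) * (Fintype.card V / 4 ^ i * v)⌋₊
            + ((W i 0).tourCost - ((W i 0).cost - ((W i 0).tourCost - (W i 0).cost)))
              * ⌊Fintype.card V / (4 : ℝ) ^ i * v⌋₊)) := by
      rw [sum_add_distrib, ← mul_sum, ← mul_sum]
      linarith
    refine h4.trans ?_
    rw [mul_sum]
    refine sum_le_sum fun i _ => ?_
    rw [← hW i, ← hb i]
    have hv0 : 0 ≤ v := le_trans (by norm_num) hv.1
    have hx : 0 ≤ Fintype.card V / (4 : ℝ) ^ i * v := by positivity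
    generalize (Fintype.card V : ℝ) / 4 ^ i * v = x at hx
    have h5 := Nat.floor_le hx
    have h6 := Nat.floor_le (mul_nonneg (by norm_num : (0 : ℝ) ≤ 4) hx)
    have h7 : (4 : ℝ) * ⌊x⌋₊ ≤ ⌊4 * x⌋₊ := by
      have : 4 * ⌊x⌋₊ ≤ ⌊4 * x⌋₊ := Nat.le_floor (by push_cast; linarith)
      exact_mod_cast this
    -- The length of the return edge, `tourCost - cost`, has the coefficient
    -- `(4 * ⌊x⌋₊ - ⌊4 * x⌋₊) / 3`, which is not positive.
    have h8 := mul_le_mul_of_nonneg_left h7 (sub_nonneg.2 (hT1 i))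
    have h9 := mul_le_mul_of_nonneg_left h5 (hb0 i)
    have h10 := mul_le_mul_of_nonneg_left h6 (hb0 i)
    linarith
  have hlog : 1.386 < Real.log 4 := by
    rw [show (4 : ℝ) = 2 ^ 2 by norm_num, Real.log_pow]
    have := Real.log_two_gt_d9
    push_cast
    linarith
  nlinarith

end Bounds

end MLP

theorem theorem2p3 {V : Type*} [Fintype V] [DecidableEq V] [PseudoMetricSpace V] :
    -- (i) multi-depot `k`-MLP
    (∀ (k : ℕ), 1 ≤ k → ∀ r : Fin k → V,
      ∃ P : MLP.PathFamily r, P.IsFeasible ∧ P.totalLatency ≤ MLP.muStar * MLP.bnslb r) ∧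
    -- (ii) single-vehicle MLP with root `r`
    (∀ r : Fin 1 → V,
      ∃ P : MLP.PathFamily r, P.IsFeasible ∧ P.totalLatency ≤ 3.03 * MLP.bnslb r) :=
  ⟨fun _ hk r => MLP.exists_totalLatency_le_muStar hk r,
    fun r => MLP.exists_totalLatency_le_of_single r⟩
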